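/- Let $N$ be a Poisson process on $[0,\infty)$ with rate $1$ and let $Z_1,Z_2,\dots$ be i.i.d. real random variables, independent of $N$, with $\mathbf{E}Z_1=1$ and $\mathbf{P}(Z_1\ge x)\sim \exp(-x^{\alpha})$ as $x\to\infty$, where $\alpha=1/2$. For $n\ge 1$ let $$\bar X_n(t)=\frac1n\sum_{i=1}^{N(nt)}Z_i-t,\qquad t\in[0,1],$$ a random element of the space $\mathbb D$ of càdlàg functions $[0,1]\to\mathbb R$ with the Skorokhod $J_1$ topology, i.e. the topology of the metric $d(\xi,\zeta)=\inf_\lambda\max(\|\lambda-e\|_\infty,\|\xi\circ\lambda-\zeta\|_\infty)$, where $\lambda$ ranges over the increasing bijections of $[0,1]$ and $e$ is the identity. For $\xi\in\mathbb D$ let $$I(\xi)=\sum_{t\in[0,1]}\big(\xi(t)-\xi(t-)\big)^{\alpha}$$ (with $\xi(0-)=\xi(0)$) if $\xi$ is non-decreasing, is a pure jump function (that is, $\xi=\sum_{i\ge1}x_i\mathbf 1_{[u_i,1]}$ with $x_i\in\mathbb R$ and distinct $u_i\in[0,1]$), satisfies $\xi(0)=0$ and is continuous at $1$; let $I(\xi)=\infty$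 otherwise. For $c,s,t\in\mathbb R$ let $$\varphi_{s,t}(\xi)=\lim_{\epsilon\downarrow0}\ \sup_{0\vee(s-\epsilon)\le u\le v\le 1\wedge(t+\epsilon)}\big(\xi(v)-\xi(u)\big),\qquad A_{c;s,t}=\{\xi\in\mathbb D:\varphi_{s,t}(\xi)\ge c\},$$ and for $m\ge1$, with $h_m=\frac1{(m+1)(m+2)}$, let $$A_m=A_{1;\frac{m+1}{m+2},\frac{m+1}{m+2}+mh_m}\cap A_{1;\frac{m}{m+2},\frac{m}{m+2}+mh_m}\cap\bigcap_{j=0}^{m-1}A_{\frac1{m^2};\frac j{m+2},\frac j{m+2}+mh_m},\qquad A=\bigcup_{m=1}^\infty A_m .$$ Then $A$ is closed in the $J_1$ topology, $$\limsup_{n\to\infty}\frac{\log\mathbf{P}(\bar X_n\in A)}{n^{\alpha}}\ \ge\ -2\qquad\text{and}\qquad \inf_{\xi\in A}I(\xi)\ \ge\ 3 .$$ Hence $\bar X_n$ does not satisfy the large deviation principle in $(\mathbb D,J_1)$ with speed $n^{\alpha}$ and rate function $I$; that is, it is not true that for every Borel set $B\subseteq\mathbb D$, with interior $B^\circ$ and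 closure $B^-$, $$-\inf_{\xi\in B^\circ}I(\xi)\le\liminf_{n\to\infty}\frac{\log\mathbf P(\bar X_n\in B)}{n^\alpha}\le\limsup_{n\to\infty}\frac{\log\mathbf P(\bar X_n\in B)}{n^\alpha}\le-\inf_{\xi\in B^-}I(\xi).$$ -/

import Mathlib

open Set Filter Topology MeasureTheory ProbabilityTheory
open scoped NNReal ENNReal unitInterval

/-- Càdlàg: right-continuous with (finite) left limits at every point. -/
def IsCadlag (f : I → ℝ) : Prop :=
  (∀ t, ContinuousWithinAt f (Ici t) t) ∧ ∀ t, ∃ l, Tendsto f (𝓝[<] t) (𝓝 l)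

/-- The Skorokhod space of real càdlàg functions on the unit interval. -/
def SkorokhodSpace : Type := {f : I → ℝ // IsCadlag f}

namespace SkorokhodSpace

instance : CoeFun SkorokhodSpace (fun _ => I → ℝ) := ⟨fun ξ => ξ.1⟩

/-- The cost of a time change `l` (an increasing bijection of the unit interval):
the maximum of `‖l - e‖` and `‖ξ ∘ l - ζ‖` in supremum norm. -/
noncomputable def timeChangeCost (ξ ζ : SkorokhodSpace) (l : I ≃o I) : ℝ≥0∞ :=
  max (⨆ t, edist (l t) t) (⨆ t, edist (ξ (l t)) (ζ t))

/-- The `J₁` distance. Its values lie in `ℝ≥0∞`, so that the suprema need no side condition. -/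
noncomputable def distJ1 (ξ ζ : SkorokhodSpace) : ℝ≥0∞ :=
  ⨅ l : I ≃o I, timeChangeCost ξ ζ l

lemma timeChangeCost_le {ξ ζ : SkorokhodSpace} {l : I ≃o I} {c : ℝ≥0∞} :
    timeChangeCost ξ ζ l ≤ c ↔ ∀ t, edist (l t) t ≤ c ∧ edist (ξ (l t)) (ζ t) ≤ c := by
  simp only [timeChangeCost, max_le_iff, iSup_le_iff]
  exact forall_and.symm

lemma distJ1_self (ξ : SkorokhodSpace) : distJ1 ξ ξ = 0 := by
  refine le_antisymm (iInf_le_of_le (OrderIso.refl I) ?_) bot_le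
  rw [timeChangeCost_le]
  intro t
  simp

lemma distJ1_comm_le (ξ ζ : SkorokhodSpace) : distJ1 ξ ζ ≤ distJ1 ζ ξ := by
  refine le_iInf fun l => iInf_le_of_le l.symm ?_
  rw [timeChangeCost_le]
  intro t
  have h := (timeChangeCost_le (ξ := ζ) (ζ := ξ) (l := l)).1 le_rfl (l.symm t)
  simp only [OrderIso.apply_symm_apply] at h
  rw [edist_comm (l.symm t), edist_comm (ξ _)]
  exact h

lemma distJ1_triangle (ξ ζ η : SkorokhodSpace) : distJ1 ξ η ≤ distJ1 ξ ζ + distJ1 ζ η := by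
  have key : ∀ l k : I ≃o I,
      distJ1 ξ η ≤ timeChangeCost ξ ζ l + timeChangeCost ζ η k := by
    intro l k
    refine iInf_le_of_le (k.trans l) ?_
    rw [timeChangeCost_le]
    intro t
    have h := (timeChangeCost_le (ξ := ξ) (ζ := ζ) (l := l)).1 le_rfl (k t)
    have h' := (timeChangeCost_le (ξ := ζ) (ζ := η) (l := k)).1 le_rfl t
    exact ⟨(edist_triangle _ (k t) _).trans (add_le_add h.1 h'.1),
      (edist_triangle _ (ζ (k t)) _).trans (add_le_add h.2 h'.2)⟩
  change _ ≤ (⨅ l, timeChangeCost ξ ζ l) + ⨅ k, timeChangeCost ζ η k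
  rw [ENNReal.iInf_add]
  refine le_iInf fun l => ?_
  rw [ENNReal.add_iInf]
  exact le_iInf fun k => key l k

/-- The topology of `SkorokhodSpace` is the `J₁` topology, the one of the `J₁` distance. -/
noncomputable instance : PseudoEMetricSpace SkorokhodSpace where
  edist := distJ1
  edist_self := distJ1_self
  edist_comm ξ ζ := le_antisymm (distJ1_comm_le ξ ζ) (distJ1_comm_le ζ ξ)
  edist_triangle := distJ1_triangle

/-- `ξ = ∑ i, x i • 1_{[u i, 1]}` for some real `x i` and pairwise distinct `u i`. -/
def IsPureJump (ξ : SkorokhodSpace) : Prop :=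
  ∃ (x : ℕ → ℝ) (u : ℕ → I), Function.Injective u ∧
    ∀ t, HasSum (fun i => (Ici (u i)).indicator (fun _ => x i) t) (ξ t)

/-- Non-decreasing pure jump functions vanishing at the origin and continuous at `1`. -/
def upJumpPaths : Set SkorokhodSpace :=
  {ξ | Monotone (ξ : I → ℝ) ∧ IsPureJump ξ ∧ ξ 0 = 0 ∧ ContinuousAt (ξ : I → ℝ) 1}

open Classical in
/-- The rate function: the sum of the jump sizes to the power `α` on `upJumpPaths`, and `∞`
elsewhere. At `t = 0` the left limit is `ξ 0` by convention, so `0` contributes no jump. -/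
noncomputable def rateFunction (α : ℝ) (ξ : SkorokhodSpace) : ℝ≥0∞ :=
  if ξ ∈ upJumpPaths then
    ∑' t : I, ENNReal.ofReal (ξ t - Function.leftLim (ξ : I → ℝ) t) ^ α
  else ⊤

/-- The supremum of `ξ v - ξ u` over `0 ∨ (s - ε) ≤ u ≤ v ≤ 1 ∧ (t + ε)`. -/
noncomputable def supIncr (ξ : SkorokhodSpace) (s t ε : ℝ) : EReal :=
  ⨆ (u : I) (v : I) (_ : s - ε ≤ u) (_ : u ≤ v) (_ : (v : ℝ) ≤ t + ε), ((ξ v - ξ u : ℝ) : EReal)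

/-- The limit of `supIncr ξ s t ε` as `ε ↓ 0`. It is written as an infimum, since `supIncr` is
monotone in `ε`; see `tendsto_supIncr`. -/
noncomputable def maxIncr (ξ : SkorokhodSpace) (s t : ℝ) : EReal :=
  ⨅ ε ∈ Ioi (0 : ℝ), supIncr ξ s t ε

lemma supIncr_mono (ξ : SkorokhodSpace) (s t : ℝ) : Monotone (supIncr ξ s t) := by
  intro a b hab
  refine iSup₂_le fun u v => iSup_le fun h1 => iSup_le fun h2 => iSup_le fun h3 => ?_
  exact le_iSup₂_of_le u v (le_iSup_of_le (by linarith) (le_iSup_of_le h2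
    (le_iSup_of_le (by linarith) le_rfl)))

lemma tendsto_supIncr (ξ : SkorokhodSpace) (s t : ℝ) :
    Tendsto (supIncr ξ s t) (𝓝[>] 0) (𝓝 (maxIncr ξ s t)) := by
  have h := (supIncr_mono ξ s t).tendsto_nhdsGT 0
  rwa [sInf_image] at h

/-- The paths that increase by at least `c` between the times `s` and `t`. -/
def incrSet (c s t : ℝ) : Set SkorokhodSpace := {ξ | (c : EReal) ≤ maxIncr ξ s t}

/-- The length `m * h_m` of the time windows, where `h_m = 1 / ((m + 1) (m + 2))`. -/
noncomputable def window (m : ℕ) : ℝ := m * (1 / (((m : ℝ) + 1) * ((m : ℝ) + 2)))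

/-- The paths that increase by `1 / m ^ 2` in each of `m` windows, and then by `1` in each of
two further windows. -/
def counterSetPiece (m : ℕ) : Set SkorokhodSpace :=
  incrSet 1 (((m : ℝ) + 1) / (m + 2)) (((m : ℝ) + 1) / (m + 2) + window m) ∩
  incrSet 1 ((m : ℝ) / (m + 2)) ((m : ℝ) / (m + 2) + window m) ∩
  ⋂ j ∈ Finset.range m,
    incrSet (1 / (m : ℝ) ^ 2) ((j : ℝ) / (m + 2)) ((j : ℝ) / (m + 2) + window m)

/-- The union of `counterSetPiece m` over `m ≥ 1`. -/
def counterSet : Set SkorokhodSpace := ⋃ m ∈ Ici 1, counterSetPiece m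

end SkorokhodSpace

/-- The large deviation principle for `X n` under `μ`, with speed `a n` and rate function `J`,
in the topology of `S`: the two bounds for all Borel sets. The logarithm has `log 0 = -∞`. -/
def SatisfiesLDP {Ω S : Type*} [MeasurableSpace Ω] [TopologicalSpace S] (μ : Measure Ω)
    (X : ℕ → Ω → S) (a : ℕ → ℝ) (J : S → ℝ≥0∞) : Prop :=
  ∀ A : Set S, MeasurableSet[borel S] A →
    -((⨅ x ∈ interior A, J x : ℝ≥0∞) : EReal)
        ≤ liminf (fun n => ENNReal.log (μ (X n ⁻¹' A)) / (a n : EReal)) atTop ∧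
    limsup (fun n => ENNReal.log (μ (X n ⁻¹' A)) / (a n : EReal)) atTop
        ≤ -((⨅ x ∈ closure A, J x : ℝ≥0∞) : EReal)

/-- A Poisson process on `[0, ∞)` with rate `r`, with non-decreasing right-continuous paths. -/
structure IsPoissonProcess {Ω : Type*} [MeasurableSpace Ω] (N : ℝ≥0 → Ω → ℕ) (r : ℝ≥0)
    (μ : Measure Ω) : Prop where
  measurable : ∀ t, Measurable (N t)
  zero : ∀ ω, N 0 ω = 0
  monotone : ∀ ω, Monotone fun t => N t ω
  rightCont : ∀ ω t, ContinuousWithinAt (fun t => N t ω) (Ici t) t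
  indepIncrements : HasIndepIncrements (fun t ω => (N t ω : ℝ)) μ
  law_increment : ∀ s t, s ≤ t →
    μ.map (fun ω => N t ω - N s ω) = poissonMeasure (r * (t - s))

/-- The time `n t` for `t` in the unit interval. -/
noncomputable def scaledTime (n : ℕ) (t : I) : ℝ≥0 := n * ⟨t, t.2.1⟩

lemma isCadlag_scaledPath {k : ℝ≥0 → ℕ} (hk : Monotone k)
    (hc : ∀ t, ContinuousWithinAt k (Ici t) t) (z : ℕ → ℝ) (n : ℕ) :
    IsCadlag fun t => (1 / (n : ℝ)) * ∑ i ∈ Finset.range (k (scaledTime n t)), z i - t := by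
  have hmono : Monotone (scaledTime n) := fun a b hab =>
    mul_le_mul_of_nonneg_left (show (⟨a, a.2.1⟩ : ℝ≥0) ≤ ⟨b, b.2.1⟩ from hab) zero_le
  have hcont : Continuous (scaledTime n) :=
    continuous_const.mul (continuous_subtype_val.subtype_mk _)
  let g : ℕ → ℝ := fun p => (1 / (n : ℝ)) * ∑ i ∈ Finset.range p, z i
  have hg : Continuous g := continuous_of_discreteTopology
  constructor
  · intro t
    have h1 : ContinuousWithinAt (fun t => k (scaledTime n t)) (Ici t) t :=
      (hc (scaledTime n t)).comp hcont.continuousWithinAt fun s hs => hmono hs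
    exact (hg.continuousAt.comp_continuousWithinAt h1).sub
      continuous_subtype_val.continuousWithinAt
  · intro t
    have h1 := (hk.comp hmono).tendsto_leftLim t
    exact ⟨_, ((hg.tendsto _).comp h1).sub (continuous_subtype_val.tendsto t |>.mono_left
      nhdsWithin_le_nhds)⟩

/-- The path `t ↦ (1 / n) ∑_{i ≤ N(n t)} Z_i - t`, for `Z` indexed from `0`. -/
noncomputable def scaledCompoundPoisson {Ω : Type*} [MeasurableSpace Ω] {N : ℝ≥0 → Ω → ℕ}
    {r : ℝ≥0} {μ : Measure Ω} (hN : IsPoissonProcess N r μ) (Z : ℕ → Ω → ℝ) (n : ℕ) (ω : Ω) :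
    SkorokhodSpace :=
  ⟨fun t => (1 / (n : ℝ)) * ∑ i ∈ Finset.range (N (scaledTime n t) ω), Z i ω - t,
    isCadlag_scaledPath (hN.monotone ω) (hN.rightCont ω) (fun i => Z i ω) n⟩

/-! The set separates cheap rises from the price that the rate function puts on them. Take `n = m ^
3`. On the time scale of the Poisson process a window then has length of order `m ^ 2`, and a rise
of the path by `1 / m ^ 2` is an excess of `m` in the sum of the jumps. This is the scale of Poisson
fluctuations: a suitable number of points in the window makes the excess happen with probability at
least a constant times a power of `1 / m`. All such demands together cost `exp (-O(m log m))`,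
negligible against `exp (-m ^ (3 / 2)) = exp (-√n)`. Only the two unit rises need big jumps, at a
price of `exp (-√n)` each, whence `-2` (`pow_mul_le_measureReal_counterSetPiece`,
`tendsto_log_pow_mul_div`).

The rate function cannot see fluctuations. A path of finite rate rises by jumps only, so a rise by
`1 / m ^ 2` costs at least `√(1 / m ^ 2) = 1 / m`; the windows are disjoint, and the total is at
least `m * (1 / m) + 1 + 1 = 3` (`three_le_rateFunction`).

The union is closed although it is infinite. Each piece is closed (`isClosed_incrSet`), and for
large `m` a unit rise is demanded close to `1` but strictly before it, which the left limit at `1`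
excludes near any given path. So the pieces form a locally finite family
(`locallyFinite_counterSetPiece`). The upper bound of a large deviation principle for this closed
set would then give `-2 ≤ -3`. -/

namespace SkorokhodSpace

/-! ### Windows, and closedness in the `J₁` topology -/

/-- The increment required in the window number `j` of `counterSetPiece m`. -/
noncomputable def requiredIncr (m j : ℕ) : ℝ := if j < m then 1 / (m : ℝ) ^ 2 else 1

lemma mem_counterSetPiece_iff {m : ℕ} {ξ : SkorokhodSpace} :
    ξ ∈ counterSetPiece m ↔ ∀ j < m + 2, ξ ∈ incrSet (requiredIncr m j)
      ((j : ℝ) / (m + 2)) ((j : ℝ) / (m + 2) + window m) := by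
  simp only [counterSetPiece, mem_inter_iff, mem_iInter, Finset.mem_range]
  constructor
  · rintro ⟨⟨h1, h2⟩, h3⟩ j hj
    rcases lt_trichotomy j m with h | rfl | h
    · simpa [requiredIncr, h] using h3 j h
    · simpa [requiredIncr] using h2
    · obtain rfl : j = m + 1 := by omega
      simpa [requiredIncr] using h1
  · intro h
    refine ⟨⟨?_, ?_⟩, fun j hj => ?_⟩
    · simpa [requiredIncr] using h (m + 1) (by omega)
    · simpa [requiredIncr] using h m (by omega)
    · simpa [requiredIncr, hj] using h j (by omega)

lemma mem_incrSet_iff {c s t : ℝ} {ξ : SkorokhodSpace} :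
    ξ ∈ incrSet c s t ↔ ∀ ε > 0, ∀ c' < c, ∃ u v : I,
      s - ε ≤ u ∧ u ≤ v ∧ (v : ℝ) ≤ t + ε ∧ c' < ξ v - ξ u := by
  simp only [incrSet, mem_ofPred_eq, maxIncr, le_iInf_iff, mem_Ioi]
  refine forall₂_congr fun ε hε => ⟨fun h c' hc' => ?_, fun h => le_of_forall_lt fun b hb => ?_⟩
  · have h' := (EReal.coe_lt_coe_iff.2 hc').trans_le h
    simp only [supIncr, lt_iSup_iff, EReal.coe_lt_coe_iff] at h'
    obtain ⟨u, v, h1, h2, h3, h4⟩ := h'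
    exact ⟨u, v, h1, h2, h3, h4⟩
  · obtain ⟨r, hr1, hr2⟩ := EReal.lt_iff_exists_real_btwn.1 hb
    obtain ⟨u, v, h1, h2, h3, h4⟩ := h r (EReal.coe_lt_coe_iff.1 hr2)
    refine hr1.trans ((EReal.coe_lt_coe_iff.2 h4).trans_le ?_)
    exact le_iSup₂_of_le u v (le_iSup_of_le h1 (le_iSup_of_le h2 (le_iSup_of_le h3 le_rfl)))

lemma mem_incrSet_of_le {c s t : ℝ} {ξ : SkorokhodSpace} {u v : I} (hu : (u : ℝ) = s)
    (hv : (v : ℝ) = t) (huv : u ≤ v) (h : c ≤ ξ v - ξ u) : ξ ∈ incrSet c s t :=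
  mem_incrSet_iff.2 fun ε hε c' hc' =>
    ⟨u, v, by linarith, huv, by linarith, by linarith⟩

lemma exists_orderIso_of_edist_lt {ξ ζ : SkorokhodSpace} {δ : ℝ} (hδ : 0 < δ)
    (h : edist ξ ζ < ENNReal.ofReal δ) :
    ∃ l : I ≃o I, ∀ t, |(l t : ℝ) - t| ≤ δ ∧ |ξ (l t) - ζ t| ≤ δ := by
  change (⨅ l, timeChangeCost ξ ζ l) < _ at h
  obtain ⟨l, hl⟩ := iInf_lt_iff.1 h
  refine ⟨l, fun t => ?_⟩
  have h2 := timeChangeCost_le.1 hl.le t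
  rw [Subtype.edist_eq, edist_dist, edist_dist, ENNReal.ofReal_le_ofReal_iff hδ.le,
    ENNReal.ofReal_le_ofReal_iff hδ.le] at h2
  exact h2

/-- A time change of cost at most `δ` moves the two times by at most `δ` and alters the increment by
at most `2 * δ`. Both errors fit into the slack in `ε` and `c'`. -/
theorem isClosed_incrSet (c s t : ℝ) : IsClosed (incrSet c s t) := by
  refine isClosed_of_closure_subset fun ζ hζ => mem_incrSet_iff.2 fun ε hε c' hc' => ?_
  set δ := min (ε / 2) ((c - c') / 3) with hδ
  have hδ0 : 0 < δ := lt_min (by linarith) (by linarith)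
  have hδ1 : δ ≤ ε / 2 := min_le_left _ _
  have hδ2 : δ ≤ (c - c') / 3 := min_le_right _ _
  obtain ⟨ξ, hξ, hd⟩ := EMetric.mem_closure_iff.1 hζ _ (ENNReal.ofReal_pos.2 hδ0)
  obtain ⟨l, hl⟩ := exists_orderIso_of_edist_lt hδ0 hd
  obtain ⟨u, v, h1, h2, h3, h4⟩ :=
    mem_incrSet_iff.1 hξ (ε / 2) (by linarith) (c' + 2 * δ) (by linarith)
  have hu := hl u
  have hv := hl v
  simp only [abs_le] at hu hv
  exact ⟨l u, l v, by linarith, l.monotone h2, by linarith, by linarith⟩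

lemma isClosed_counterSetPiece (m : ℕ) : IsClosed (counterSetPiece m) :=
  ((isClosed_incrSet _ _ _).inter (isClosed_incrSet _ _ _)).inter
    (isClosed_biInter fun _ _ => isClosed_incrSet _ _ _)

lemma add_window_add (m : ℕ) (j : ℝ) :
    j / (m + 2) + window m + 1 / (((m : ℝ) + 1) * (m + 2)) = (j + 1) / (m + 2) := by
  unfold window
  field_simp
  ring

/-- A path has a left limit at `1`, so near `1` it cannot increase by `1` before the time `1`. -/
theorem locallyFinite_counterSetPiece : LocallyFinite counterSetPiece := by
  intro ζ
  obtain ⟨l, hl⟩ := ζ.2.2 1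
  have h1 : Metric.ball l (1 / 8) ∈ 𝓝 l := Metric.ball_mem_nhds _ (by norm_num)
  obtain ⟨a, ha, hsub⟩ := (mem_nhdsLT_iff_exists_Ioo_subset' (zero_lt_one (α := I))).1 (hl h1)
  have ha1 : (a : ℝ) < 1 := ha
  set δ := min ((1 - (a : ℝ)) / 2) (1 / 8) with hδ
  have hδ0 : 0 < δ := lt_min (by linarith) (by norm_num)
  have hδ1 : δ ≤ (1 - (a : ℝ)) / 2 := min_le_left _ _
  have hδ2 : δ ≤ 1 / 8 := min_le_right _ _
  refine ⟨Metric.eball ζ (ENNReal.ofReal δ), Metric.eball_mem_nhds _ (ENNReal.ofReal_pos.2 hδ0), ?_⟩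
  -- For larger `m` the window number `m`, widened by `1 / (m + 2)`, starts within `3 * (1 - a) / 8`
  -- of `1` and ends before `1`. A time shift by at most `(1 - a) / 2` leaves it to the right of
  -- `a`.
  refine (finite_Iic ⌈8 / (1 - (a : ℝ))⌉₊).subset ?_
  rintro m ⟨ξ, hξm, hξ⟩
  rw [mem_Iic]
  by_contra! hm
  have hm1 : 8 / (1 - (a : ℝ)) < m := Nat.lt_of_ceil_lt hm
  have hm2 : 1 / ((m : ℝ) + 2) < (1 - a) / 8 := by
    rw [div_lt_iff₀ (by linarith)] at hm1
    rw [div_lt_div_iff₀ (by positivity) (by norm_num)]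
    linarith
  have hξ1 := mem_counterSetPiece_iff.1 hξm m (by omega)
  simp only [requiredIncr, lt_irrefl, if_false] at hξ1
  obtain ⟨u, v, h1, h2, h3, h4⟩ := mem_incrSet_iff.1 hξ1 (1 / ((m : ℝ) + 2)) (by positivity)
    (1 / 2) (by norm_num)
  have hw := add_window_add m m
  have e1 : ((m : ℝ) + 1) / (m + 2) = 1 - 1 / (m + 2) := by field_simp; ring
  have e2 : (m : ℝ) / (m + 2) = 1 - 2 * (1 / (m + 2)) := by field_simp; ring
  have hpos : 0 < 1 / (((m : ℝ) + 1) * (m + 2)) := by positivity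
  have hv1 : (v : ℝ) < 1 := by linarith
  rw [Metric.mem_eball, edist_comm] at hξ
  obtain ⟨k, hk⟩ := exists_orderIso_of_edist_lt hδ0 hξ
  have hku := hk u
  have hkv := hk v
  rw [abs_le, abs_le] at hku hkv
  -- The time change fixes `1`, so the rise is carried to times before `1`, where `ζ` stays within
  -- `1 / 8` of its left limit.
  have hkv1 : k v < 1 := by
    have hk1 : k 1 = 1 := k.map_top
    exact hk1 ▸ k.strictMono hv1
  have hau : a < k u := by
    rw [← Subtype.coe_lt_coe]
    linarith [hku.1.1]
  have b1 := hsub ⟨hau, (k.monotone h2).trans_lt hkv1⟩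
  have b2 := hsub ⟨hau.trans_le (k.monotone h2), hkv1⟩
  simp only [mem_preimage, Metric.mem_ball, Real.dist_eq, abs_lt] at b1 b2
  linarith [b1.1, b2.2, hku.2.2, hkv.2.1]

theorem isClosed_counterSet : IsClosed counterSet := by
  rw [counterSet, biUnion_eq_iUnion]
  exact (locallyFinite_counterSetPiece.comp_injective Subtype.val_injective).isClosed_iUnion
    fun m => isClosed_counterSetPiece m

end SkorokhodSpace

/-! ### The rate function is at least `3` on the set -/

lemma ENNReal.tsum_rpow_half_le {ι : Type*} (f : ι → ℝ≥0∞) :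
    (∑' i, f i) ^ (1 / 2 : ℝ) ≤ ∑' i, f i ^ (1 / 2 : ℝ) := by
  have hfin : ∀ s : Finset ι, (∑ i ∈ s, f i) ^ (1 / 2 : ℝ) ≤ ∑ i ∈ s, f i ^ (1 / 2 : ℝ) := by
    intro s
    classical
    induction s using Finset.induction_on with
    | empty => simp
    | insert a s ha ih =>
      rw [Finset.sum_insert ha, Finset.sum_insert ha]
      exact (ENNReal.rpow_add_le_add_rpow _ _ (by norm_num) (by norm_num)).trans (by gcongr)
  rw [← ENNReal.le_rpow_inv_iff (by norm_num), ENNReal.tsum_eq_iSup_sum]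
  refine iSup_le fun s => ?_
  rw [ENNReal.le_rpow_inv_iff (by norm_num)]
  exact (hfin s).trans (ENNReal.sum_le_tsum s)

namespace SkorokhodSpace

variable {ξ : SkorokhodSpace} {x : ℕ → ℝ} {u : ℕ → I}

lemma hasSum_sub_of_hasSum
    (hs : ∀ t, HasSum (fun i => (Ici (u i)).indicator (fun _ => x i) t) (ξ t)) {a b : I}
    (hab : a ≤ b) :
    HasSum (fun i => (u ⁻¹' Ioc a b).indicator x i) (ξ b - ξ a) := by
  refine ((hs b).sub (hs a)).congr_fun fun i => ?_
  by_cases h1 : u i ≤ a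
  · simp [indicator, h1, h1.trans hab]
  · simp [indicator, h1, not_le.1 h1]

lemma summable_abs_of_hasSum
    (hs : ∀ t, HasSum (fun i => (Ici (u i)).indicator (fun _ => x i) t) (ξ t)) :
    Summable fun i => |x i| := by
  have h := (hs 1).summable
  refine (h.congr fun i => ?_).abs
  simp [indicator, unitInterval.le_one']

/-- By dominated convergence the left limit at `u k` is the sum over the `u i` strictly before `u
k`. As the `u i` are distinct, only the term `x k` is lost. -/
lemma jump_eq_of_hasSum (hu : Function.Injective u)
    (hs : ∀ t, HasSum (fun i => (Ici (u i)).indicator (fun _ => x i) t) (ξ t)) (h0 : ξ 0 = 0)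
    (k : ℕ) : ξ (u k) - Function.leftLim (ξ : I → ℝ) (u k) = x k := by
  have single : ∀ k, HasSum (fun i => if u i = u k then x i else 0) (x k) := by
    intro k
    convert hasSum_ite_eq k (x k) using 2 with i
    by_cases h : i = k
    · simp [h]
    · simp [h, hu.ne h]
  rcases eq_or_ne (u k) 0 with h | h
  -- At time `0` there is no jump by convention, and indeed `x k = ξ 0 = 0`.
  · rw [leftLim_eq_of_isBot (fun t => by rw [h]; exact t.2.1), sub_self]
    have h1 := hs 0
    rw [h0, ← h] at h1
    refine h1.unique ?_
    convert single k using 2 with i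
    have : u i ≤ u k ↔ u i = u k := by
      rw [h]
      exact ⟨fun h => le_antisymm h (u i).2.1, fun h => h.le⟩
    simp [indicator, this]
  · have hpos : 0 < u k := unitInterval.pos_iff_ne_zero.2 h
    have hne : (𝓝[<] (u k)).NeBot := nhdsLT_neBot_of_exists_lt ⟨0, hpos⟩
    have ht : Tendsto (ξ : I → ℝ) (𝓝[<] (u k))
        (𝓝 (∑' i, (Ioi (u i)).indicator (fun _ => x i) (u k))) := by
      have := tendsto_tsum_of_dominated_convergence
        (f := fun t i => (Ici (u i)).indicator (fun _ => x i) t)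
        (g := fun i => (Ioi (u i)).indicator (fun _ => x i) (u k)) (𝓕 := 𝓝[<] (u k))
        (summable_abs_of_hasSum hs) (fun i => ?_) (Eventually.of_forall fun t i => ?_)
      · exact this.congr fun t => (hs t).tsum_eq
      · refine tendsto_const_nhds.congr' ?_
        by_cases hi : u i < u k
        · filter_upwards [Ioo_mem_nhdsLT hi] with t ht
          simp [indicator, hi, ht.1.le]
        · filter_upwards [self_mem_nhdsWithin] with t ht
          simp [indicator, hi, lt_of_lt_of_le ht (not_lt.1 hi)]
      · simp only [indicator]
        split_ifs <;> simp
    rw [leftLim_eq_of_tendsto ht, sub_eq_iff_eq_add]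
    have hsum : Summable fun i => (Ioi (u i)).indicator (fun _ => x i) (u k) := by
      refine Summable.of_norm_bounded (summable_abs_of_hasSum hs) fun i => ?_
      simp only [indicator]
      split_ifs <;> simp
    refine (hs (u k)).unique ?_
    convert (single k).add hsum.hasSum using 2 with i
    rcases lt_trichotomy (u i) (u k) with h | h | h
    · simp [indicator, h, h.le, h.ne]
    · simp [indicator, h]
    · simp [indicator, not_le.2 h, not_lt.2 h.le, h.ne']

lemma ofReal_sub_le_of_hasSum (hx : ∀ i, 0 ≤ x i)
    (hs : ∀ t, HasSum (fun i => (Ici (u i)).indicator (fun _ => x i) t) (ξ t)) {a b : I}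
    (hab : a ≤ b) {S : Set ℕ} (hS : u ⁻¹' Ioc a b ⊆ S) :
    ENNReal.ofReal (ξ b - ξ a) ≤ ∑' i, S.indicator (fun i => ENNReal.ofReal (x i)) i := by
  have h := hasSum_sub_of_hasSum hs hab
  rw [← h.tsum_eq, ENNReal.ofReal_tsum_of_nonneg (fun i => indicator_nonneg (fun i _ => hx i) i)
    h.summable]
  refine ENNReal.tsum_le_tsum fun i => ?_
  by_cases hi : i ∈ u ⁻¹' Ioc a b
  · simp [indicator_of_mem hi, indicator_of_mem (hS hi)]
  · simp [indicator_of_notMem hi]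

/-- Within a window the jumps add up to at least the required rise, so by subadditivity of the
square root their roots add up to at least its root. Disjointness of the windows allows summation
over them. -/
theorem three_le_rateFunction {m : ℕ} (hm : 1 ≤ m) (hξ : ξ ∈ counterSetPiece m) :
    3 ≤ rateFunction (1 / 2) ξ := by
  rw [rateFunction]
  split_ifs with hup
  swap
  · exact le_top
  obtain ⟨hmono, ⟨x, u, hu, hs⟩, h0, -⟩ := hup
  have hjump := jump_eq_of_hasSum hu hs h0
  have hx : ∀ i, 0 ≤ x i := fun i => by
    rw [← hjump, sub_nonneg]
    exact hmono.leftLim_le le_rfl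
  set h := 1 / (((m : ℝ) + 1) * (m + 2)) with hh
  have hpos : 0 < h := by positivity
  -- Consecutive windows are a distance `h` apart, so they stay disjoint when widened by `h / 3` on
  -- both sides.
  let W : ℕ → Set ℕ := fun j => {i | (j : ℝ) / (m + 2) - h / 3 ≤ u i ∧
    (u i : ℝ) ≤ (j : ℝ) / (m + 2) + window m + h / 3}
  have hdisj : ∀ j j', j < j' → Disjoint (W j) (W j') := by
    intro j j' hj
    refine Set.disjoint_left.2 fun i hi hi' => ?_
    have hw := add_window_add m j
    have : ((j : ℝ) + 1) / (m + 2) ≤ (j' : ℝ) / (m + 2) := by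
      gcongr
      exact_mod_cast hj
    linarith [hi.2, hi'.1]
  have hpd : (↑(Finset.range (m + 2)) : Set ℕ).PairwiseDisjoint W := by
    intro j _ j' _ hjj
    rcases hjj.lt_or_gt with h | h
    · exact hdisj _ _ h
    · exact (hdisj _ _ h).symm
  have hW : ∀ j < m + 2, ENNReal.ofReal (requiredIncr m j) ^ (1 / 2 : ℝ) ≤
      ∑' i, (W j).indicator (fun i => ENNReal.ofReal (x i) ^ (1 / 2 : ℝ)) i := by
    intro j hj
    have h1 : ENNReal.ofReal (requiredIncr m j) ≤
        ∑' i, (W j).indicator (fun i => ENNReal.ofReal (x i)) i := by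
      refine le_of_forall_lt fun b hb => ?_
      have hb' : b.toReal < requiredIncr m j := by
        rw [← ENNReal.ofReal_toReal hb.ne_top] at hb
        exact (ENNReal.ofReal_lt_ofReal_iff').1 hb |>.1
      obtain ⟨p, q, h1, h2, h3, h4⟩ :=
        mem_incrSet_iff.1 (mem_counterSetPiece_iff.1 hξ j hj) (h / 3) (by positivity) _ hb'
      rw [← ENNReal.ofReal_toReal hb.ne_top]
      refine lt_of_lt_of_le ((ENNReal.ofReal_lt_ofReal_iff_of_nonneg ENNReal.toReal_nonneg).2 h4)
        (ofReal_sub_le_of_hasSum hx hs h2 fun i hi => ⟨?_, ?_⟩)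
      · exact h1.trans (Subtype.coe_le_coe.2 hi.1.le)
      · exact (Subtype.coe_le_coe.2 hi.2).trans h3
    refine (ENNReal.rpow_le_rpow h1 (by norm_num)).trans ((ENNReal.tsum_rpow_half_le _).trans_eq ?_)
    refine tsum_congr fun i => ?_
    by_cases hi : i ∈ W j
    · simp [hi]
    · simp [hi]
  calc (3 : ℝ≥0∞) = ∑ j ∈ Finset.range (m + 2),
        ENNReal.ofReal (requiredIncr m j) ^ (1 / 2 : ℝ) := by
        have hm' : (0 : ℝ) < m := by exact_mod_cast hm
        have e : ∀ j ∈ Finset.range m,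
            ENNReal.ofReal (requiredIncr m j) ^ (1 / 2 : ℝ) = ENNReal.ofReal (1 / (m : ℝ)) := by
          intro j hj
          rw [requiredIncr, if_pos (Finset.mem_range.1 hj),
            ENNReal.ofReal_rpow_of_nonneg (by positivity) (by norm_num), ← Real.sqrt_eq_rpow,
            ← one_div_pow, Real.sqrt_sq (by positivity)]
        rw [Finset.sum_range_succ, Finset.sum_range_succ, Finset.sum_congr rfl e, Finset.sum_const,
          Finset.card_range, nsmul_eq_mul, ← ENNReal.ofReal_natCast,
          ← ENNReal.ofReal_mul hm'.le, mul_one_div_cancel hm'.ne']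
        simp [requiredIncr]
        norm_num
    _ ≤ ∑ j ∈ Finset.range (m + 2),
        ∑' i, (W j).indicator (fun i => ENNReal.ofReal (x i) ^ (1 / 2 : ℝ)) i :=
        Finset.sum_le_sum fun j hj => hW j (Finset.mem_range.1 hj)
    _ = ∑' i, ∑ j ∈ Finset.range (m + 2),
        (W j).indicator (fun i => ENNReal.ofReal (x i) ^ (1 / 2 : ℝ)) i :=
        (Summable.tsum_finsetSum fun _ _ => ENNReal.summable).symm
    _ ≤ ∑' i, ENNReal.ofReal (x i) ^ (1 / 2 : ℝ) := by
        refine ENNReal.tsum_le_tsum fun i => ?_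
        rw [← Finset.indicator_biUnion_apply _ _ hpd]
        exact indicator_le_self _ _ i
    _ = ∑' i, ENNReal.ofReal (ξ (u i) - Function.leftLim (ξ : I → ℝ) (u i)) ^ (1 / 2 : ℝ) := by
        simp only [hjump]
    _ ≤ _ := ENNReal.tsum_comp_le_tsum_of_injective hu
        fun t => ENNReal.ofReal (ξ t - Function.leftLim (ξ : I → ℝ) t) ^ (1 / 2 : ℝ)

theorem three_le_iInf_rateFunction : 3 ≤ ⨅ ξ ∈ counterSet, rateFunction (1 / 2) ξ := by
  refine le_iInf₂ fun ξ hξ => ?_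
  obtain ⟨m, hm, h⟩ := mem_iUnion₂.1 hξ
  exact three_le_rateFunction hm h

end SkorokhodSpace

/-! ### Probabilistic estimates -/

/-- The Stirling sequence is decreasing for `k ≥ 1`, and its first value is `e / √2`. -/
lemma factorial_le_exp_one_mul {k : ℕ} (hk : 1 ≤ k) :
    (k.factorial : ℝ) ≤ Real.exp 1 * √k * (k / Real.exp 1) ^ k := by
  obtain ⟨l, rfl⟩ : ∃ l, k = l + 1 := ⟨k - 1, by omega⟩
  have h : Stirling.stirlingSeq (l + 1) ≤ Stirling.stirlingSeq 1 :=
    Stirling.stirlingSeq'_antitone (Nat.zero_le l)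
  have hpos : 0 < ((l + 1 : ℕ) : ℝ) := by positivity
  rw [Stirling.stirlingSeq_one, Stirling.stirlingSeq, div_le_iff₀ (by positivity)] at h
  refine h.trans_eq ?_
  rw [Real.sqrt_mul (by norm_num)]
  field_simp

/-- A local lower bound for the Poisson probabilities. -/
lemma poissonMeasure_real_singleton_ge {r : ℝ≥0} (hr : 0 < r) {k : ℕ} (hk : 1 ≤ k) :
    Real.exp (-(((k : ℝ) - r) ^ 2 / r)) / (Real.exp 1 * √k) ≤ (poissonMeasure r).real {k} := by
  have hr' : (0 : ℝ) < r := hr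
  have hk' : (0 : ℝ) < k := by exact_mod_cast hk
  rw [poissonMeasure_real_singleton]
  -- The bound `x ≤ exp (x - 1)` at `x = k / r`; the exponent splits off the Gaussian term in `h2`.
  have h1 : ((k : ℝ) / r) ^ k ≤ Real.exp (k * (k / r - 1)) := by
    rw [Real.exp_nat_mul]
    gcongr
    linarith [Real.add_one_le_exp ((k : ℝ) / r - 1)]
  have h2 : (k : ℝ) * (k / r - 1) = (k - r) ^ 2 / r + k - r := by field_simp; ring
  rw [h2, div_pow, div_le_iff₀ (by positivity)] at h1
  rw [div_le_div_iff₀ (by positivity) (by positivity)]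
  calc Real.exp (-(((k : ℝ) - r) ^ 2 / r)) * k.factorial
      ≤ Real.exp (-(((k : ℝ) - r) ^ 2 / r)) * (Real.exp 1 * √k * (k / Real.exp 1) ^ k) := by
        gcongr
        exact factorial_le_exp_one_mul hk
    _ = Real.exp (-(((k : ℝ) - r) ^ 2 / r)) * Real.exp (-k) * (Real.exp 1 * √k) * k ^ k := by
        rw [div_pow, ← Real.exp_nat_mul, mul_one, Real.exp_neg (k : ℝ)]
        ring
    _ ≤ Real.exp (-(((k : ℝ) - r) ^ 2 / r)) * Real.exp (-k) * (Real.exp 1 * √k) *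
        (Real.exp ((k - r) ^ 2 / r + k - r) * r ^ k) := by gcongr
    _ = Real.exp (-(((k : ℝ) - r) ^ 2 / r) + -k + ((k - r) ^ 2 / r + k - r)) * r ^ k *
        (Real.exp 1 * √k) := by
        rw [Real.exp_add, Real.exp_add]
        ring
    _ = _ := by
        congr 3
        ring

section Probability

variable {Ω : Type*} [MeasurableSpace Ω] {μ : Measure Ω}

lemma pow_le_measureReal_increments {N : ℝ≥0 → Ω → ℕ} {r : ℝ≥0} (hN : IsPoissonProcess N r μ)
    {t : ℕ → ℝ≥0} (ht : Monotone t) (k : ℕ → ℕ) (L : ℕ) {θ : ℝ} (hθ : 0 ≤ θ)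
    (h : ∀ i < L, θ ≤ (poissonMeasure (r * (t (i + 1) - t i))).real {k i}) :
    θ ^ L ≤ μ.real {ω | ∀ i < L, N (t (i + 1)) ω - N (t i) ω = k i} := by
  have hind := (hN.indepIncrements.nat ht).measure_inter_preimage_eq_mul
    (Finset.range L) (sets := fun i => {(k i : ℝ)}) fun i _ => measurableSet_singleton _
  have e : ∀ i, (fun ω => (N (t (i + 1)) ω : ℝ) - N (t i) ω) ⁻¹' {(k i : ℝ)} =
      (fun ω => N (t (i + 1)) ω - N (t i) ω) ⁻¹' {k i} := by
    intro i
    ext ω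
    have : N (t i) ω ≤ N (t (i + 1)) ω := hN.monotone ω (ht i.le_succ)
    simp only [mem_preimage, mem_singleton_iff, ← Nat.cast_sub this, Nat.cast_inj]
  simp only [e] at hind
  have e2 : {ω | ∀ i < L, N (t (i + 1)) ω - N (t i) ω = k i} =
      ⋂ i ∈ Finset.range L, (fun ω => N (t (i + 1)) ω - N (t i) ω) ⁻¹' {k i} := by
    ext ω
    simp
  rw [e2, measureReal_def, hind, ENNReal.toReal_prod, ← Finset.card_range L, ← Finset.prod_const,
    Finset.card_range]
  refine Finset.prod_le_prod (fun _ _ => hθ) fun i hi => ?_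
  refine (h i (Finset.mem_range.1 hi)).trans_eq ?_
  rw [← hN.law_increment _ _ (ht i.le_succ), measureReal_def, Measure.map_apply _
    (measurableSet_singleton _)]
  exact (hN.measurable _).sub (hN.measurable _)

lemma exists_tail_bounds {Y : Ω → ℝ}
    (htail : Asymptotics.IsEquivalent atTop (fun x : ℝ => μ.real {ω | x ≤ Y ω})
      (fun x : ℝ => Real.exp (-(x ^ (1 / 2 : ℝ))))) :
    ∃ X : ℝ, 1 ≤ X ∧ ∀ x, X ≤ x → Real.exp (-√x) / 2 ≤ μ.real {ω | x ≤ Y ω} ∧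
      μ.real {ω | x ≤ Y ω} ≤ 2 * Real.exp (-√x) := by
  rw [Asymptotics.isEquivalent_iff_tendsto_one
    (Eventually.of_forall fun x => (Real.exp_pos _).ne')] at htail
  have h := htail.eventually (Ioo_mem_nhds (show (1 / 2 : ℝ) < 1 by norm_num)
    (show (1 : ℝ) < 2 by norm_num))
  obtain ⟨X, hX⟩ := eventually_atTop.1 h
  refine ⟨max X 1, le_max_right _ _, fun x hx => ?_⟩
  have h1 := hX x ((le_max_left _ _).trans hx)
  simp only [Pi.div_apply, ← Real.sqrt_eq_rpow] at h1
  rw [lt_div_iff₀ (Real.exp_pos _), div_lt_iff₀ (Real.exp_pos _)] at h1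
  constructor <;> linarith [h1.1, h1.2]

variable [IsProbabilityMeasure μ]

/-- A random variable with mean `0` and a square integrable positive part is not much below `0`
with a probability that is not too small. -/
lemma measureReal_neg_le_ge {W g : Ω → ℝ} (hWm : Measurable W) (hW : Integrable W μ)
    (hmean : ∫ ω, W ω ∂μ = 0) (hg : Integrable (fun ω => g ω ^ 2) μ) (hWg : ∀ ω, W ω ≤ g ω)
    {V b : ℝ} (hV : 0 < V) (hgV : ∫ ω, g ω ^ 2 ∂μ ≤ V) (hb : 0 < b) :
    b ^ 2 / (V + 2 * b ^ 2) ≤ μ.real {ω | -b ≤ W ω} := by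
  set E : Set Ω := {ω | -b ≤ W ω} with hE
  have hEm : MeasurableSet E := measurableSet_le measurable_const hWm
  -- On `E`, `W ≤ g` and the arithmetic-geometric mean inequality; off `E`, `W < -b`. The weights
  -- make the integral of the `g` term at most `b / 2`, half of what the constant `-b` takes away.
  have hpt : ∀ ω, W ω ≤ b / (2 * V) * g ω ^ 2 + E.indicator (fun _ => V / (2 * b) + b) ω - b := by
    intro ω
    have hs : g ω ≤ b / (2 * V) * g ω ^ 2 + V / (2 * b) := by
      have : b / (2 * V) * g ω ^ 2 + V / (2 * b) - g ω = (b * g ω - V) ^ 2 / (2 * V * b) := by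
        field_simp
        ring
      have : 0 ≤ (b * g ω - V) ^ 2 / (2 * V * b) := by positivity
      linarith
    by_cases h : ω ∈ E
    · rw [indicator_of_mem h]
      linarith [hWg ω]
    · rw [indicator_of_notMem h]
      have h' : W ω < -b := not_le.1 h
      have : 0 ≤ b / (2 * V) * g ω ^ 2 := by positivity
      linarith
  have hind : Integrable (E.indicator fun _ => V / (2 * b) + b) μ :=
    (integrable_const _).indicator hEm
  have h := integral_mono hW (((hg.const_mul (b / (2 * V))).add hind).sub (integrable_const b)) hpt
  rw [hmean, integral_sub' ((hg.const_mul (b / (2 * V))).add hind) (integrable_const b),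
    integral_add' (hg.const_mul (b / (2 * V))) hind, integral_const_mul,
    integral_indicator_const _ hEm, integral_const] at h
  simp only [probReal_univ, smul_eq_mul, one_mul] at h
  have h3 : b / (2 * V) * ∫ ω, g ω ^ 2 ∂μ ≤ b / 2 := by
    calc _ ≤ b / (2 * V) * V := by gcongr
      _ = b / 2 := by field_simp
  rw [div_le_iff₀ (by positivity)]
  have h4 : b / 2 ≤ μ.real E * (V / (2 * b) + b) := by linarith
  have h5 : μ.real E * (V / (2 * b) + b) * (2 * b) = μ.real E * (V + 2 * b ^ 2) := by
    field_simp
  nlinarith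

/-- A sum of `k` random variables with mean `1` is at least `k - b` with a probability that is not
too small. -/
lemma measureReal_sub_le_sum_ge {Z : ℕ → Ω → ℝ} (hZmeas : ∀ i, Measurable (Z i))
    (hZint : ∀ i, Integrable (Z i) μ) (hZmean : ∀ i, ∫ ω, Z i ω ∂μ = 1)
    (hZsq : ∀ i, Integrable (fun ω => max (Z i ω) 0 ^ 2) μ) {C : ℝ} (hC : 0 < C)
    (hZC : ∀ i, ∫ ω, max (Z i ω) 0 ^ 2 ∂μ ≤ C) (s : Finset ℕ) (hs : s.Nonempty)
    {b : ℝ} (hb : 0 < b) :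
    b ^ 2 / (s.card ^ 2 * C + 2 * b ^ 2) ≤ μ.real {ω | s.card - b ≤ ∑ i ∈ s, Z i ω} := by
  have hsum : Integrable (fun ω => ∑ i ∈ s, Z i ω) μ := integrable_finsetSum _ fun i _ => hZint i
  have hcard : (0 : ℝ) < s.card := by exact_mod_cast hs.card_pos
  have hg2 : Integrable (fun ω => (s.card : ℝ) * ∑ i ∈ s, max (Z i ω) 0 ^ 2) μ :=
    (integrable_finsetSum _ fun i _ => hZsq i).const_mul _
  -- Cauchy–Schwarz stands in for a variance: the lower tail of `Z` is not controlled, so no second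
  -- moment is available. The loss is only polynomial in the number of terms.
  have hle : ∀ ω, (∑ i ∈ s, max (Z i ω) 0) ^ 2 ≤ (s.card : ℝ) * ∑ i ∈ s, max (Z i ω) 0 ^ 2 :=
    fun ω => sq_sum_le_card_mul_sum_sq
  have hg : Integrable (fun ω => (∑ i ∈ s, max (Z i ω) 0) ^ 2) μ := by
    refine hg2.mono' ?_ (Eventually.of_forall fun ω => ?_)
    · exact ((Finset.measurable_sum _ fun i _ => (hZmeas i).max measurable_const).pow_const
        2).aestronglyMeasurable
    · rw [Real.norm_of_nonneg (sq_nonneg _)]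
      exact hle ω
  have h := measureReal_neg_le_ge (μ := μ) (W := fun ω => ∑ i ∈ s, Z i ω - s.card)
    (g := fun ω => ∑ i ∈ s, max (Z i ω) 0) (V := s.card ^ 2 * C) (b := b)
    ((Finset.measurable_sum _ fun i _ => hZmeas i).sub_const _) (hsum.sub (integrable_const _))
    ?_ hg (fun ω => ?_) (by positivity) ?_ hb
  · convert h using 4 with ω
    constructor <;> intro h <;> linarith
  · rw [integral_sub hsum (integrable_const _), integral_finsetSum _ fun i _ => hZint i]
    simp [hZmean]
  · have : ∑ i ∈ s, Z i ω ≤ ∑ i ∈ s, max (Z i ω) 0 := Finset.sum_le_sum fun i _ => le_max_left _ _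
    linarith
  · refine (integral_mono hg hg2 hle).trans ?_
    rw [integral_const_mul, integral_finsetSum _ fun i _ => hZsq i, pow_two, mul_assoc]
    gcongr
    rw [← nsmul_eq_mul]
    exact Finset.sum_le_card_nsmul _ _ _ fun i _ => hZC i

/-- The layer cake formula, with `exp (-√t) ≤ 6! / t ^ 3` making the integrand at most `2 * 720 * t
^ (-2)` beyond `X`. -/
lemma integrable_sq_max_of_tail {Y : Ω → ℝ} (hY : Measurable Y) {X : ℝ} (hX : 1 ≤ X)
    (htail : ∀ x, X ≤ x → μ.real {ω | x ≤ Y ω} ≤ 2 * Real.exp (-√x)) :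
    Integrable (fun ω => max (Y ω) 0 ^ 2) μ := by
  have hm : Measurable fun ω => max (Y ω) 0 := hY.max measurable_const
  rw [← lintegral_ofReal_ne_top_iff_integrable (hm.pow_const 2).aestronglyMeasurable
    (Eventually.of_forall fun ω => sq_nonneg _)]
  have h := lintegral_rpow_eq_lintegral_meas_le_mul (μ := μ) (f := fun ω => max (Y ω) 0)
    (Eventually.of_forall fun ω => le_max_right _ _) hm.aemeasurable (p := 2) (by norm_num)
  simp only [Real.rpow_two] at h
  rw [h]
  refine ENNReal.mul_ne_top ENNReal.ofReal_ne_top ?_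
  rw [← Ioc_union_Ioi_eq_Ioi (show (0 : ℝ) ≤ X by linarith)]
  refine ne_top_of_le_ne_top ?_ (lintegral_union_le _ _ _)
  refine ENNReal.add_ne_top.2 ⟨?_, ?_⟩
  · have : ∫⁻ t in Ioc 0 X, μ {a | t ≤ max (Y a) 0} * ENNReal.ofReal (t ^ ((2 : ℝ) - 1)) ≤
        ∫⁻ t in Ioc 0 X, ENNReal.ofReal X := by
      refine setLIntegral_mono measurable_const fun t ht => ?_
      calc _ ≤ 1 * ENNReal.ofReal X := by
            gcongr
            · exact prob_le_one
            · norm_num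
              exact ht.2
        _ = _ := one_mul _
    refine ne_top_of_le_ne_top ?_ this
    rw [setLIntegral_const]
    exact ENNReal.mul_ne_top ENNReal.ofReal_ne_top (by simp)
  · have hint : IntegrableOn (fun t : ℝ => 1440 * t ^ (-2 : ℝ)) (Ioi X) :=
      (integrableOn_Ioi_rpow_of_lt (by norm_num) (by linarith)).const_mul _
    have : ∫⁻ t in Ioi X, μ {a | t ≤ max (Y a) 0} * ENNReal.ofReal (t ^ ((2 : ℝ) - 1)) ≤
        ∫⁻ t in Ioi X, ENNReal.ofReal (1440 * t ^ (-2 : ℝ)) := by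
      refine setLIntegral_mono (by fun_prop) fun t ht => ?_
      have ht' : X < t := ht
      have ht0 : 0 < t := by linarith
      have e : {a | t ≤ max (Y a) 0} = {a | t ≤ Y a} := by
        ext a
        simp [ht0]
      rw [e, ← ofReal_measureReal, ← ENNReal.ofReal_mul measureReal_nonneg]
      refine ENNReal.ofReal_le_ofReal ?_
      have h6 := Real.pow_div_factorial_le_exp (√t) (Real.sqrt_nonneg t) 6
      have h7 : √t ^ 6 = t ^ 3 := by
        rw [show 6 = 2 * 3 by norm_num, pow_mul, Real.sq_sqrt ht0.le]
      rw [h7] at h6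
      have h8 : Real.exp (-√t) ≤ 720 / t ^ 3 := by
        rw [Real.exp_neg, ← one_div, div_le_div_iff₀ (Real.exp_pos _) (by positivity)]
        rw [div_le_iff₀ (by positivity)] at h6
        norm_num [Nat.factorial] at h6 ⊢
        linarith
      have e2 : t ^ ((2 : ℝ) - 1) = t := by norm_num
      have e3 : t ^ (-2 : ℝ) = 1 / t ^ 2 := by
        rw [Real.rpow_neg ht0.le, Real.rpow_two, one_div]
      rw [e2, e3]
      calc _ ≤ 2 * (720 / t ^ 3) * t := by
            gcongr
            exact (htail t ht'.le).trans (by gcongr)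
        _ = _ := by field_simp; ring
    refine ne_top_of_le_ne_top ?_ this
    rw [lintegral_ofReal_ne_top_iff_integrable hint.aestronglyMeasurable]
    · exact hint
    · filter_upwards [ae_restrict_mem measurableSet_Ioi] with t ht
      have : (0 : ℝ) < t := by linarith [show X < t from ht]
      positivity

/-- Sums over disjoint blocks of independent variables are independent; the induction splits off the
last block from the union of the others. -/
lemma measureReal_forall_le_sum {Z : ℕ → Ω → ℝ} (hZmeas : ∀ i, Measurable (Z i))
    (hZindep : iIndepFun Z μ) (S : ℕ → Finset ℕ) (y : ℕ → ℝ) (L : ℕ)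
    (hS : ∀ i < L, ∀ j < L, i < j → Disjoint (S i) (S j)) :
    μ.real {ω | ∀ i < L, y i ≤ ∑ k ∈ S i, Z k ω} =
      ∏ i ∈ Finset.range L, μ.real {ω | y i ≤ ∑ k ∈ S i, Z k ω} := by
  induction L with
  | zero => simp
  | succ L ih =>
    rw [Finset.prod_range_succ, ← ih fun i hi j hj => hS i (by omega) j (by omega)]
    set T := (Finset.range L).biUnion S with hT
    have hdis : Disjoint T (S L) := by
      rw [hT, Finset.disjoint_biUnion_left]
      intro i hi
      exact hS i (by simp at hi; omega) L (by omega) (by simpa using hi)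
    have hind := hZindep.indepFun_finset T (S L) hdis hZmeas
    let B : Set (T → ℝ) := {z | ∀ i < L, y i ≤ ∑ k ∈ S i, if h : k ∈ T then z ⟨k, h⟩ else 0}
    let B' : Set (S L → ℝ) := {z | y L ≤ ∑ k, z k}
    have hB : MeasurableSet B := by
      have : B = ⋂ i ∈ Finset.range L,
          {z : T → ℝ | y i ≤ ∑ k ∈ S i, if h : k ∈ T then z ⟨k, h⟩ else 0} := by
        ext z
        simp [B]
      rw [this]
      refine Finset.measurableSet_biInter _ fun i _ => measurableSet_le measurable_const ?_
      refine Finset.measurable_sum _ fun k _ => ?_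
      by_cases h : k ∈ T
      · simp only [h, dif_pos]
        exact measurable_pi_apply _
      · simp only [h, dif_neg, not_false_eq_true]
        exact measurable_const
    have hB' : MeasurableSet B' :=
      measurableSet_le measurable_const (Finset.measurable_sum _ fun k _ => measurable_pi_apply k)
    have e1 : (fun ω (i : T) => Z i ω) ⁻¹' B = {ω | ∀ i < L, y i ≤ ∑ k ∈ S i, Z k ω} := by
      ext ω
      refine forall₂_congr fun i hi => ?_
      have e : ∑ k ∈ S i, (if h : k ∈ T then (fun j : T => Z j ω) ⟨k, h⟩ else 0) =
          ∑ k ∈ S i, Z k ω := Finset.sum_congr rfl fun k hk =>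
        dif_pos (show k ∈ T from Finset.mem_biUnion.2 ⟨i, Finset.mem_range.2 hi, hk⟩)
      rw [← e]
    have e2 : (fun ω (i : S L) => Z i ω) ⁻¹' B' = {ω | y L ≤ ∑ k ∈ S L, Z k ω} := by
      ext ω
      simp only [B', mem_preimage, mem_ofPred_eq, Finset.sum_coe_sort (S L) fun k => Z k ω]
    have h := hind.measure_inter_preimage_eq_mul _ _ hB hB'
    rw [e1, e2] at h
    have e3 : {ω | ∀ i < L + 1, y i ≤ ∑ k ∈ S i, Z k ω} =
        {ω | ∀ i < L, y i ≤ ∑ k ∈ S i, Z k ω} ∩ {ω | y L ≤ ∑ k ∈ S L, Z k ω} := by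
      ext ω
      simp only [mem_inter_iff, mem_ofPred_eq, Nat.lt_succ_iff_lt_or_eq]
      exact ⟨fun h => ⟨fun i hi => h i (Or.inl hi), h L (Or.inr rfl)⟩,
        fun h i hi => hi.elim (h.1 i) fun e => e ▸ h.2⟩
    rw [e3, measureReal_def, h, ENNReal.toReal_mul, measureReal_def, measureReal_def]

end Probability

/-! ### The grid of windows and gaps -/

/-- The sum of the first `i` terms of the sequence `a, b, a, b, …`. -/
def alternatingSum (a b i : ℕ) : ℕ := (i / 2) * (a + b) + (i % 2) * a

lemma alternatingSum_two_mul (a b j : ℕ) : alternatingSum a b (2 * j) = j * (a + b) := by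
  simp [alternatingSum]

lemma alternatingSum_two_mul_add_one (a b j : ℕ) :
    alternatingSum a b (2 * j + 1) = j * (a + b) + a := by
  have h1 : (2 * j + 1) / 2 = j := by omega
  have h2 : (2 * j + 1) % 2 = 1 := by omega
  simp [alternatingSum, h1, h2]

lemma alternatingSum_succ (a b i : ℕ) :
    alternatingSum a b (i + 1) = alternatingSum a b i + if i % 2 = 0 then a else b := by
  obtain ⟨j, rfl | rfl⟩ := i.even_or_odd'
  · simp [alternatingSum_two_mul_add_one, alternatingSum_two_mul]
  · have h2 : (2 * j + 1) % 2 = 1 := by omega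
    rw [show 2 * j + 1 + 1 = 2 * (j + 1) by ring, alternatingSum_two_mul,
      alternatingSum_two_mul_add_one, h2]
    simp
    ring

lemma monotone_alternatingSum (a b : ℕ) : Monotone (alternatingSum a b) :=
  monotone_nat_of_le_succ fun i => by simp [alternatingSum_succ]

/-- The ends of the windows of `counterSetPiece m`, on the time scale of the Poisson process. -/
noncomputable def windowTime (m i : ℕ) : ℝ≥0 :=
  (m : ℝ≥0) ^ 3 * alternatingSum m 1 i / (((m : ℝ≥0) + 1) * (m + 2))

lemma windowTime_zero (m : ℕ) : windowTime m 0 = 0 := by simp [windowTime, alternatingSum]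

lemma monotone_windowTime (m : ℕ) : Monotone (windowTime m) := by
  intro i j hij
  unfold windowTime
  gcongr
  exact monotone_alternatingSum m 1 hij

lemma windowTime_succ_sub (m i : ℕ) : ((windowTime m (i + 1) - windowTime m i : ℝ≥0) : ℝ) =
    m ^ 3 * (if i % 2 = 0 then m else 1 : ℕ) / ((m + 1) * (m + 2)) := by
  rw [NNReal.coe_sub (monotone_windowTime m i.le_succ)]
  simp only [windowTime, alternatingSum_succ]
  split_ifs <;> push_cast <;> ring

lemma coe_scaledTime (n : ℕ) (t : I) : (scaledTime n t : ℝ) = n * t :=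
  congrArg (· * (t : ℝ)) (NNReal.coe_natCast n)

namespace SkorokhodSpace

lemma cube_mul_window (m : ℕ) :
    (m : ℝ) ^ 3 * window m = m ^ 3 * m / ((m + 1) * (m + 2)) := by
  unfold window
  ring

variable {Ω : Type*} [MeasurableSpace Ω] {μ : Measure Ω} {N : ℝ≥0 → Ω → ℕ} {r : ℝ≥0}

/-- If the Poisson process has `κ` points in every window and `G` between any two, then the path
is in `counterSetPiece m` as soon as the jumps in the windows have large enough sums. -/
lemma scaledCompoundPoisson_mem_counterSetPiece (hN : IsPoissonProcess N r μ) {Z : ℕ → Ω → ℝ}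
    {m : ℕ} (hm : 1 ≤ m) {κ G : ℕ} {ω : Ω}
    (hinc : ∀ i < 2 * m + 3, N (windowTime m (i + 1)) ω - N (windowTime m i) ω =
      if i % 2 = 0 then κ else G)
    (hsum : ∀ j < m + 2, (m : ℝ) ^ 3 * (requiredIncr m j + window m) ≤
      ∑ i ∈ Finset.Ico (j * (κ + G)) (j * (κ + G) + κ), Z i ω) :
    scaledCompoundPoisson hN Z (m ^ 3) ω ∈ counterSetPiece m := by
  have hm' : (0 : ℝ) < m := by exact_mod_cast hm
  have hcount : ∀ i ≤ 2 * m + 3, N (windowTime m i) ω = alternatingSum κ G i := by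
    intro i
    induction i with
    | zero => simp [windowTime_zero, hN.zero, alternatingSum]
    | succ i ih =>
      intro hi
      have h1 := hinc i (by omega)
      have h2 : N (windowTime m i) ω ≤ N (windowTime m (i + 1)) ω :=
        hN.monotone ω (monotone_windowTime m i.le_succ)
      rw [alternatingSum_succ, ← ih (by omega), ← h1]
      omega
  rw [mem_counterSetPiece_iff]
  intro j hj
  have hj' : (j : ℝ) + 1 ≤ m + 2 := by exact_mod_cast hj
  have hw := add_window_add m j
  have hpos : 0 < 1 / (((m : ℝ) + 1) * (m + 2)) := by positivity
  have hw0 : 0 ≤ window m := by unfold window; positivity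
  have hj0 : 0 ≤ (j : ℝ) / (m + 2) := by positivity
  have hle : (j : ℝ) / (m + 2) + window m ≤ 1 := by
    have : ((j : ℝ) + 1) / (m + 2) ≤ 1 := (div_le_one (by positivity)).2 hj'
    linarith
  let u : I := ⟨(j : ℝ) / (m + 2), hj0, by linarith⟩
  let v : I := ⟨(j : ℝ) / (m + 2) + window m, by linarith, hle⟩
  have hu : scaledTime (m ^ 3) u = windowTime m (2 * j) := by
    apply NNReal.eq
    rw [coe_scaledTime, windowTime, alternatingSum_two_mul, show (u : ℝ) = (j : ℝ) / (m + 2) from rfl]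
    push_cast
    field_simp
  have hv : scaledTime (m ^ 3) v = windowTime m (2 * j + 1) := by
    apply NNReal.eq
    rw [coe_scaledTime, windowTime, alternatingSum_two_mul_add_one,
      show (v : ℝ) = (j : ℝ) / (m + 2) + window m from rfl, window]
    push_cast
    field_simp
  refine mem_incrSet_of_le (u := u) (v := v) rfl rfl (Subtype.mk_le_mk.2 (by linarith)) ?_
  change _ ≤ (1 / ((m ^ 3 : ℕ) : ℝ)) * ∑ i ∈ Finset.range (N (scaledTime (m ^ 3) v) ω), Z i ω - v -
    ((1 / ((m ^ 3 : ℕ) : ℝ)) * ∑ i ∈ Finset.range (N (scaledTime (m ^ 3) u) ω), Z i ω - u)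
  rw [hu, hv, hcount _ (by omega), hcount _ (by omega), alternatingSum_two_mul,
    alternatingSum_two_mul_add_one]
  have h := hsum j hj
  rw [Finset.sum_Ico_eq_sub _ (by omega)] at h
  have huv : (v : ℝ) - u = window m := by simp [u, v]
  rw [← le_div_iff₀' (by positivity)] at h
  -- The drift `-t` costs the length of the window, which the jumps must make up for.
  have h2 : requiredIncr m j + (v - u) ≤ (1 / ((m ^ 3 : ℕ) : ℝ)) *
      (∑ i ∈ Finset.range (j * (κ + G) + κ), Z i ω - ∑ i ∈ Finset.range (j * (κ + G)), Z i ω) := by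
    rw [huv]
    refine h.trans_eq ?_
    push_cast
    ring
  rw [mul_sub] at h2
  linarith

end SkorokhodSpace

/-! ### The probability of a single piece -/

lemma poissonMeasure_real_singleton_ge_of_sq_le {p : ℝ≥0} (hp : 0 < p) {k m : ℕ} (hk : 1 ≤ k)
    (hm : 1 ≤ m) (hkm : k ≤ 4 * m ^ 2) (h : ((k : ℝ) - p) ^ 2 ≤ 18 * p) :
    Real.exp (-18) / (2 * Real.exp 1) / (m : ℝ) ^ 2 ≤ (poissonMeasure p).real {k} := by
  have hp' : (0 : ℝ) < p := hp
  have hm' : (1 : ℝ) ≤ m := by exact_mod_cast hm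
  have hk' : (0 : ℝ) < k := by exact_mod_cast hk
  refine le_trans ?_ (poissonMeasure_real_singleton_ge hp hk)
  have h1 : √k ≤ 2 * m := by
    rw [Real.sqrt_le_left (by positivity)]
    have : (k : ℝ) ≤ 4 * m ^ 2 := by exact_mod_cast hkm
    linarith
  have h2 : ((k : ℝ) - p) ^ 2 / p ≤ 18 := (div_le_iff₀ hp').2 h
  rw [div_div]
  have h3 : Real.exp 1 * √k ≤ 2 * Real.exp 1 * (m : ℝ) ^ 2 := by
    have : (m : ℝ) ≤ m ^ 2 := le_self_pow₀ hm' (by norm_num)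
    calc Real.exp 1 * √k ≤ Real.exp 1 * (2 * m) := by gcongr
      _ ≤ Real.exp 1 * (2 * m ^ 2) := by gcongr
      _ = _ := by ring
  gcongr

section LowerBound

open SkorokhodSpace

variable {Ω : Type*} [MeasurableSpace Ω] {μ : Measure Ω} [IsProbabilityMeasure μ]

/-- The lower bound for the probability of the `m`-th piece, from bounds for single windows. -/
lemma pow_mul_le_measureReal_counterSetPiece
    {N : ℝ≥0 → Ω → ℕ} (hN : IsPoissonProcess N 1 μ)
    {Z : ℕ → Ω → ℝ} (hZmeas : ∀ i, Measurable (Z i)) (hZindep : iIndepFun Z μ)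
    (hNZ : IndepFun (fun ω t => N t ω) (fun ω i => Z i ω) μ)
    {m K G : ℕ} (hm : 1 ≤ m) {θ ρ : ℝ} (hθ : 0 ≤ θ) (hρ : 0 ≤ ρ)
    (hinc : ∀ i < 2 * m + 3, θ ≤ (poissonMeasure (1 * (windowTime m (i + 1) - windowTime m i))).real
      {if i % 2 = 0 then K + 1 else G})
    (hsum : ∀ a, θ ≤ μ.real {ω | (m : ℝ) ^ 3 * window m + m ≤
      ∑ k ∈ Finset.Ico (a + 1) (a + 1 + K), Z k ω})
    (hsmall : ∀ i, θ ≤ μ.real {ω | 0 ≤ Z i ω})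
    (hbig : ∀ i, θ * ρ ≤ μ.real {ω | (m : ℝ) ^ 3 ≤ Z i ω}) :
    θ ^ (4 * m + 7) * ρ ^ 2 ≤
      μ.real (scaledCompoundPoisson hN Z (m ^ 3) ⁻¹' counterSetPiece m) := by
  have hm' : (0 : ℝ) < m := by exact_mod_cast hm
  let A : Set (ℝ≥0 → ℕ) := {f | ∀ i < 2 * m + 3,
    f (windowTime m (i + 1)) - f (windowTime m i) = if i % 2 = 0 then K + 1 else G}
  let a : ℕ → ℕ := fun j => j * (K + 1 + G)
  -- The first jump of each window is set apart: it is the big one in the last two windows and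
  -- merely nonnegative in the others. The `m + 2` blocks of remaining jumps come first in the list,
  -- then the `m + 2` single jumps. With `2 * m + 3` Poisson increments this makes `4 * m + 7`
  -- factors `θ`.
  let S : ℕ → Finset ℕ := fun i =>
    if i < m + 2 then Finset.Ico (a i + 1) (a i + 1 + K) else {a (i - (m + 2))}
  let y : ℕ → ℝ := fun i =>
    if i < m + 2 then (m : ℝ) ^ 3 * window m + m else if i < 2 * m + 2 then 0 else (m : ℝ) ^ 3
  let B : Set (ℕ → ℝ) := {z | ∀ i < 2 * m + 4, y i ≤ ∑ k ∈ S i, z k}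
  have hA : MeasurableSet A := by
    have : A = ⋂ i ∈ Finset.range (2 * m + 3), (fun f : ℝ≥0 → ℕ =>
        f (windowTime m (i + 1)) - f (windowTime m i)) ⁻¹' {if i % 2 = 0 then K + 1 else G} := by
      ext f
      simp [A]
    rw [this]
    refine Finset.measurableSet_biInter _ fun i _ => measurableSet_preimage ?_
      (measurableSet_singleton _)
    exact (measurable_pi_apply _).sub (measurable_pi_apply _)
  have hB : MeasurableSet B := by
    have : B = ⋂ i ∈ Finset.range (2 * m + 4), {z : ℕ → ℝ | y i ≤ ∑ k ∈ S i, z k} := by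
      ext z
      simp [B]
    rw [this]
    exact Finset.measurableSet_biInter _ fun i _ => measurableSet_le measurable_const
      (Finset.measurable_sum _ fun k _ => measurable_pi_apply k)
  have hamono : ∀ i j, i < j → a i + (K + 1) ≤ a j := by
    intro i j hij
    calc a i + (K + 1) ≤ (i + 1) * (K + 1 + G) := by simp only [a]; nlinarith
      _ ≤ a j := Nat.mul_le_mul_right _ hij
  have hS : ∀ i < 2 * m + 4, ∀ j < 2 * m + 4, i < j → Disjoint (S i) (S j) := by
    intro i _ j _ hij
    rw [Finset.disjoint_left]
    intro k hk hk'
    by_cases hi : i < m + 2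
    · by_cases hj : j < m + 2
      · simp only [S, hi, hj, if_true, Finset.mem_Ico] at hk hk'
        have := hamono i j hij
        omega
      · simp only [S, hi, hj, if_true, if_false, Finset.mem_Ico, Finset.mem_singleton] at hk hk'
        rcases lt_trichotomy i (j - (m + 2)) with h | h | h
        · have := hamono _ _ h
          omega
        · rw [← h] at hk'
          omega
        · have := hamono _ _ h
          omega
    · have hj : ¬ j < m + 2 := by omega
      simp only [S, hi, hj, if_false, Finset.mem_singleton] at hk hk'
      have := hamono (i - (m + 2)) (j - (m + 2)) (by omega)
      omega
  have hPA : θ ^ (2 * m + 3) ≤ μ.real ((fun ω t => N t ω) ⁻¹' A) :=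
    pow_le_measureReal_increments hN (monotone_windowTime m) _ _ hθ hinc
  have hPB : θ ^ (2 * m + 4) * ρ ^ 2 ≤ μ.real ((fun ω i => Z i ω) ⁻¹' B) := by
    have h := measureReal_forall_le_sum hZmeas hZindep S y (2 * m + 4) hS
    change _ ≤ μ.real {ω | ∀ i < 2 * m + 4, y i ≤ ∑ k ∈ S i, Z k ω}
    rw [h, Finset.prod_range_succ, Finset.prod_range_succ]
    have hlast : ∀ i, ¬ i < 2 * m + 2 → θ * ρ ≤ μ.real {ω | y i ≤ ∑ k ∈ S i, Z k ω} := by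
      intro i hi
      have hi' : ¬ i < m + 2 := by omega
      simpa [y, S, hi, hi'] using hbig (a (i - (m + 2)))
    have hfirst : θ ^ (2 * m + 2) ≤
        ∏ i ∈ Finset.range (2 * m + 2), μ.real {ω | y i ≤ ∑ k ∈ S i, Z k ω} := by
      rw [← Finset.card_range (2 * m + 2), ← Finset.prod_const, Finset.card_range]
      refine Finset.prod_le_prod (fun _ _ => hθ) fun i hi => ?_
      by_cases hi' : i < m + 2
      · simpa [y, S, hi'] using hsum (a i)
      · simpa [y, S, hi', Finset.mem_range.1 hi] using hsmall (a (i - (m + 2)))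
    calc θ ^ (2 * m + 4) * ρ ^ 2 = θ ^ (2 * m + 2) * (θ * ρ) * (θ * ρ) := by ring
      _ ≤ _ := by
        gcongr
        · exact hlast _ (by omega)
        · exact hlast _ (by omega)
  have hsub : (fun ω t => N t ω) ⁻¹' A ∩ (fun ω i => Z i ω) ⁻¹' B ⊆
      scaledCompoundPoisson hN Z (m ^ 3) ⁻¹' counterSetPiece m := by
    rintro ω ⟨h1, h2⟩
    refine scaledCompoundPoisson_mem_counterSetPiece hN hm h1 fun j hj => ?_
    have h3 : (m : ℝ) ^ 3 * window m + m ≤ ∑ k ∈ Finset.Ico (a j + 1) (a j + 1 + K), Z k ω := by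
      simpa [y, S, hj] using h2 j (by omega)
    have h4 : y (j + (m + 2)) ≤ Z (a j) ω := by
      simpa [S] using h2 (j + (m + 2)) (by omega)
    have h5 : (m : ℝ) ^ 3 * requiredIncr m j ≤ y (j + (m + 2)) + m := by
      have h6 : ¬ j + (m + 2) < m + 2 := by omega
      by_cases hjm : j < m
      · have h7 : j + (m + 2) < 2 * m + 2 := by omega
        simp only [requiredIncr, y, hjm, h6, h7, if_true, if_false]
        apply le_of_eq
        field_simp
        ring
      · have h7 : ¬ j + (m + 2) < 2 * m + 2 := by omega
        simp only [requiredIncr, y, hjm, h6, h7, if_false]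
        linarith
    rw [Finset.sum_eq_sum_Ico_succ_bot (by omega), mul_add]
    have h8 : j * (K + 1 + G) + (K + 1) = a j + 1 + K := by simp only [a]; ring
    rw [h8]
    change _ ≤ Z (a j) ω + ∑ k ∈ Finset.Ico (a j + 1) (a j + 1 + K), Z k ω
    linarith
  have hmul := hNZ.measure_inter_preimage_eq_mul _ _ hA hB
  calc θ ^ (4 * m + 7) * ρ ^ 2 = θ ^ (2 * m + 3) * (θ ^ (2 * m + 4) * ρ ^ 2) := by ring
    _ ≤ μ.real ((fun ω t => N t ω) ⁻¹' A) * μ.real ((fun ω i => Z i ω) ⁻¹' B) := by gcongr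
    _ = μ.real ((fun ω t => N t ω) ⁻¹' A ∩ (fun ω i => Z i ω) ⁻¹' B) := by
      simp only [measureReal_def, hmul, ENNReal.toReal_mul]
    _ ≤ _ := measureReal_mono hsub

end LowerBound

/-- Numbers of points in the windows and between them that are not too improbable. -/
lemma exists_window_counts {m : ℕ} (hm : 4 ≤ m) : ∃ K G : ℕ, 0 < K ∧ (K : ℝ) ≤ 2 * m ^ 2 ∧
    (m : ℝ) ^ 3 * SkorokhodSpace.window m + 2 * m ≤ K ∧
    ∀ i, Real.exp (-18) / (2 * Real.exp 1) / (m : ℝ) ^ 2 ≤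
      (poissonMeasure (1 * (windowTime m (i + 1) - windowTime m i))).real
        {if i % 2 = 0 then K + 1 else G} := by
  have hm4 : (4 : ℝ) ≤ m := by exact_mod_cast hm
  have hsq : 4 * (m : ℝ) ≤ m ^ 2 := by nlinarith
  set p : ℝ := (m : ℝ) ^ 3 / ((m + 1) * (m + 2)) with hp
  have hpm : p ≤ m := by
    rw [hp, div_le_iff₀ (by positivity)]
    nlinarith
  have hmp : (m : ℝ) / 2 ≤ p := by
    rw [hp, le_div_iff₀ (by positivity)]
    nlinarith [mul_nonneg (show (0 : ℝ) ≤ m by linarith) (sub_nonneg.2 hsq)]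
  have hp0 : 0 < p := by linarith
  have hmp1 : m * p ≤ (m : ℝ) ^ 2 := by nlinarith
  have hmp2 : (m : ℝ) ^ 2 / 2 ≤ m * p := by nlinarith
  have hlam : (m : ℝ) ^ 3 * SkorokhodSpace.window m = m * p := by
    rw [SkorokhodSpace.cube_mul_window, hp]
    ring
  -- Of the excess `2 * m` over the Poisson mean `m * p`, one `m` is the rise to be produced, the
  -- other lets the sum of the jumps fall short of its mean by `m`.
  have hK1 : m * p + 2 * m ≤ ⌈m * p + 2 * m⌉₊ := Nat.le_ceil _
  have hK2 : (⌈m * p + 2 * m⌉₊ : ℝ) < m * p + 2 * m + 1 := Nat.ceil_lt_add_one (by positivity)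
  have hG1 : p ≤ ⌈p⌉₊ := Nat.le_ceil _
  have hG2 : (⌈p⌉₊ : ℝ) < p + 1 := Nat.ceil_lt_add_one (by positivity)
  have hKpos : 0 < ⌈m * p + 2 * m⌉₊ := Nat.ceil_pos.2 (by positivity)
  have hGpos : 0 < ⌈p⌉₊ := Nat.ceil_pos.2 hp0
  generalize ⌈m * p + 2 * m⌉₊ = K at hK1 hK2 hKpos
  generalize ⌈p⌉₊ = G at hG1 hG2 hGpos
  refine ⟨K, G, hKpos, by linarith, hlam ▸ hK1, fun i => ?_⟩
  have hrate := windowTime_succ_sub m i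
  rw [one_mul]
  split_ifs at hrate ⊢ with hi
  · have hrate' : ((windowTime m (i + 1) - windowTime m i : ℝ≥0) : ℝ) = m * p := by
      rw [hrate, hp]
      ring
    refine poissonMeasure_real_singleton_ge_of_sq_le ?_ (by omega) (by omega) ?_ ?_
    · rw [← NNReal.coe_pos, hrate']
      positivity
    · have : (K : ℝ) + 1 ≤ 4 * m ^ 2 := by linarith
      exact_mod_cast this
    · rw [hrate']
      push_cast
      calc ((K : ℝ) + 1 - m * p) ^ 2 ≤ (3 * m) ^ 2 := by
            refine pow_le_pow_left₀ ?_ ?_ 2 <;> linarith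
        -- The constant `18` comes from `9 * m ^ 2` and `m ^ 2 / 2 ≤ m * p`.
        _ ≤ 18 * (m * p) := by linarith
  · have hrate' : ((windowTime m (i + 1) - windowTime m i : ℝ≥0) : ℝ) = p := by
      rw [hrate, hp]
      simp
    refine poissonMeasure_real_singleton_ge_of_sq_le ?_ hGpos (by omega) ?_ ?_
    · rw [← NNReal.coe_pos, hrate']
      exact hp0
    · have : (G : ℝ) ≤ 4 * m ^ 2 := by linarith
      exact_mod_cast this
    · rw [hrate']
      calc ((G : ℝ) - p) ^ 2 ≤ 1 ^ 2 := by
            refine pow_le_pow_left₀ ?_ ?_ 2 <;> linarith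
        _ ≤ 18 * p := by linarith

/-! ### Asymptotics along the cubes -/

section Limit

open SkorokhodSpace

variable {Ω : Type*} [MeasurableSpace Ω] {μ : Measure Ω} [IsProbabilityMeasure μ]

lemma exists_pow_mul_le_measureReal_counterSet
    {N : ℝ≥0 → Ω → ℕ} (hN : IsPoissonProcess N 1 μ)
    {Z : ℕ → Ω → ℝ} (hZmeas : ∀ i, Measurable (Z i)) (hZindep : iIndepFun Z μ)
    (hZident : ∀ i, IdentDistrib (Z i) (Z 0) μ μ)
    (hNZ : IndepFun (fun ω t => N t ω) (fun ω i => Z i ω) μ)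
    (hZtail : Asymptotics.IsEquivalent atTop (fun x : ℝ => μ.real {ω | x ≤ Z 0 ω})
      (fun x : ℝ => Real.exp (-(x ^ (1 / 2 : ℝ)))))
    (hZint : Integrable (Z 0) μ) (hZmean : ∫ ω, Z 0 ω ∂μ = 1) :
    ∃ c : ℝ, 0 < c ∧ ∀ᶠ m : ℕ in atTop,
      (c / (m : ℝ) ^ 2) ^ (4 * m + 7) * Real.exp (-√((m : ℝ) ^ 3)) ^ 2 ≤
        μ.real (scaledCompoundPoisson hN Z (m ^ 3) ⁻¹' counterSet) := by
  obtain ⟨X, hX1, hX⟩ := exists_tail_bounds hZtail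
  have htail : ∀ i x, μ.real {ω | x ≤ Z i ω} = μ.real {ω | x ≤ Z 0 ω} := fun i x =>
    congrArg ENNReal.toReal ((hZident i).measure_mem_eq measurableSet_Ici)
  have hident : ∀ i, IdentDistrib (fun ω => max (Z i ω) 0 ^ 2) (fun ω => max (Z 0 ω) 0 ^ 2) μ μ :=
    fun i => (hZident i).comp ((measurable_id.max measurable_const).pow_const 2)
  have hsq := integrable_sq_max_of_tail (hZmeas 0) hX1 fun x hx => (hX x hx).2
  set C := ∫ ω, max (Z 0 ω) 0 ^ 2 ∂μ + 1 with hC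
  have hCpos : 0 < C := by
    have : 0 ≤ ∫ ω, max (Z 0 ω) 0 ^ 2 ∂μ := integral_nonneg fun ω => sq_nonneg _
    linarith
  have hZsum := measureReal_sub_le_sum_ge hZmeas (fun i => (hZident i).integrable_iff.2 hZint)
    (fun i => (hZident i).integral_eq.trans hZmean) (fun i => (hident i).integrable_iff.2 hsq) hCpos
    (fun i => by rw [(hident i).integral_eq]; linarith)
  set c₁ := Real.exp (-18) / (2 * Real.exp 1) with hc₁
  -- This is `m ^ 2` times the bound of `measureReal_sub_le_sum_ge` at `b = m`, after enlarging its
  -- denominator by `K ≤ 2 * m ^ 2` and `m ^ 2 ≤ m ^ 4`.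
  set c₂ := 1 / (4 * C + 2) with hc₂
  set c₃ := Real.exp (-√X) / 2 with hc₃
  set c := min c₁ (min c₂ c₃) with hc
  have hc1 : c ≤ c₁ := min_le_left _ _
  have hc2 : c ≤ c₂ := (min_le_right _ _).trans (min_le_left _ _)
  have hc3 : c ≤ c₃ := (min_le_right _ _).trans (min_le_right _ _)
  have hc3' : c₃ ≤ 1 / 2 := by
    have : Real.exp (-√X) ≤ 1 := Real.exp_le_one_iff.2 (neg_nonpos.2 (Real.sqrt_nonneg X))
    linarith
  have hcpos : 0 < c := lt_min (by positivity) (lt_min (by positivity) (by positivity))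
  refine ⟨c, hcpos, ?_⟩
  filter_upwards [eventually_ge_atTop 4, eventually_ge_atTop ⌈X⌉₊] with m hm hmX
  have hm4 : (4 : ℝ) ≤ m := by exact_mod_cast hm
  have hmX' : X ≤ m := Nat.ceil_le.1 hmX
  have hm2 : (1 : ℝ) ≤ (m : ℝ) ^ 2 := one_le_pow₀ (by linarith)
  have hm3 : X ≤ (m : ℝ) ^ 3 := hmX'.trans (le_self_pow₀ (by linarith) (by norm_num))
  have hcm : c / (m : ℝ) ^ 2 ≤ c := div_le_self hcpos.le hm2
  obtain ⟨K, G, hKpos, hK3, hK1, hpois⟩ := exists_window_counts hm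
  refine (pow_mul_le_measureReal_counterSetPiece hN hZmeas hZindep hNZ (K := K) (G := G)
    (by omega : 1 ≤ m) (by positivity) (Real.exp_pos _).le ?_ ?_ ?_ ?_).trans
    (measureReal_mono (preimage_mono
      (subset_biUnion_of_mem (u := counterSetPiece) (mem_Ici.2 (by omega : 1 ≤ m)))))
  · exact fun i _ => (div_le_div_of_nonneg_right hc1 (by positivity)).trans (hpois i)
  · intro a
    have h := hZsum (Finset.Ico (a + 1) (a + 1 + K)) (by simpa using hKpos) (b := m) (by linarith)
    have hcard : (Finset.Ico (a + 1) (a + 1 + K)).card = K := by simp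
    rw [hcard] at h
    refine le_trans ?_ (h.trans (measureReal_mono fun ω hω => ?_))
    · have hK4 : (K : ℝ) ^ 2 ≤ (2 * m ^ 2) ^ 2 := by gcongr
      calc c / (m : ℝ) ^ 2 ≤ c₂ / (m : ℝ) ^ 2 := by gcongr
        _ = (m : ℝ) ^ 2 / ((2 * m ^ 2) ^ 2 * C + 2 * (m ^ 2 * m ^ 2)) := by
          rw [hc₂]
          field_simp
          ring
        _ ≤ (m : ℝ) ^ 2 / (K ^ 2 * C + 2 * m ^ 2) := by
          gcongr
          nlinarith
    · have hω' : (K : ℝ) - m ≤ ∑ k ∈ Finset.Ico (a + 1) (a + 1 + K), Z k ω := hω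
      change (m : ℝ) ^ 3 * window m + m ≤ ∑ k ∈ Finset.Ico (a + 1) (a + 1 + K), Z k ω
      linarith
  · intro i
    calc c / (m : ℝ) ^ 2 ≤ c₃ := hcm.trans hc3
      _ ≤ μ.real {ω | X ≤ Z i ω} := by
        rw [htail]
        exact (hX X le_rfl).1
      _ ≤ _ := measureReal_mono fun ω hω => le_trans (by linarith) (show X ≤ Z i ω from hω)
  · intro i
    rw [htail]
    refine le_trans ?_ (hX _ hm3).1
    rw [div_eq_inv_mul _ (2 : ℝ)]
    gcongr
    rw [inv_eq_one_div]
    exact hcm.trans (hc3.trans hc3')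

/-- The logarithm is `(4 * m + 7) * (log c - 2 * log m) - 2 * m ^ (3 / 2)`, whose first term is of
smaller order. -/
lemma tendsto_log_pow_mul_div {c : ℝ} (hc : 0 < c) :
    Tendsto (fun m : ℕ => Real.log
      ((c / (m : ℝ) ^ 2) ^ (4 * m + 7) * Real.exp (-√((m : ℝ) ^ 3)) ^ 2) / √((m : ℝ) ^ 3))
      atTop (𝓝 (-2)) := by
  have h1 : Tendsto (fun x : ℝ => Real.log x / √x) atTop (𝓝 0) := by
    simpa only [Real.sqrt_eq_rpow] using
      (isLittleO_log_rpow_atTop (show (0 : ℝ) < 1 / 2 by norm_num)).tendsto_div_nhds_zero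
  have h2 : Tendsto (fun x : ℝ => Real.log c / √x) atTop (𝓝 0) :=
    Real.tendsto_sqrt_atTop.const_div_atTop _
  have h3 : Tendsto (fun x : ℝ => 4 + 7 / x) atTop (𝓝 (4 + 0)) :=
    tendsto_const_nhds.add (tendsto_id.const_div_atTop _)
  have h := ((h3.mul (h2.sub (h1.const_mul 2))).sub_const 2).comp tendsto_natCast_atTop_atTop
    (α := ℕ)
  simp only [mul_zero, sub_zero, zero_sub] at h
  refine h.congr' ?_
  filter_upwards [eventually_gt_atTop 0] with m hm
  have hm' : (0 : ℝ) < m := by exact_mod_cast hm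
  have hs : √((m : ℝ) ^ 3) = m * √m := by
    rw [show (m : ℝ) ^ 3 = m ^ 2 * m by ring, Real.sqrt_mul (by positivity),
      Real.sqrt_sq hm'.le]
  have hpos : 0 < √(m : ℝ) := Real.sqrt_pos.2 hm'
  rw [Real.log_mul (by positivity) (by positivity), Real.log_pow, Real.log_pow, Real.log_exp,
    Real.log_div hc.ne' (by positivity), Real.log_pow, hs]
  simp only [Function.comp_apply]
  push_cast
  field_simp
  ring

theorem neg_two_le_limsup_log_measure_counterSet
    {N : ℝ≥0 → Ω → ℕ} (hN : IsPoissonProcess N 1 μ)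
    {Z : ℕ → Ω → ℝ} (hZmeas : ∀ i, Measurable (Z i)) (hZindep : iIndepFun Z μ)
    (hZident : ∀ i, IdentDistrib (Z i) (Z 0) μ μ)
    (hNZ : IndepFun (fun ω t => N t ω) (fun ω i => Z i ω) μ)
    (hZtail : Asymptotics.IsEquivalent atTop (fun x : ℝ => μ.real {ω | x ≤ Z 0 ω})
      (fun x : ℝ => Real.exp (-(x ^ (1 / 2 : ℝ)))))
    (hZint : Integrable (Z 0) μ) (hZmean : ∫ ω, Z 0 ω ∂μ = 1) :
    -2 ≤ limsup (fun n : ℕ => ENNReal.log (μ (scaledCompoundPoisson hN Z n ⁻¹' counterSet)) /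
      (((n : ℝ) ^ (1 / 2 : ℝ) : ℝ) : EReal)) atTop := by
  obtain ⟨c, hc, hev⟩ := exists_pow_mul_le_measureReal_counterSet hN hZmeas hZindep hZident hNZ
    hZtail hZint hZmean
  refine le_of_forall_lt fun b hb => ?_
  obtain ⟨s, hbs, hs⟩ := EReal.lt_iff_exists_real_btwn.1 hb
  refine hbs.trans_le (le_limsup_of_frequently_le' ?_)
  have hs' : s < -2 := by
    rw [← EReal.coe_lt_coe_iff]
    exact hs
  -- For a lower bound on the limsup it is enough to look at the `n` that are cubes.
  refine (tendsto_pow_atTop (α := ℕ) (n := 3) (by norm_num)).frequently (Eventually.frequently ?_)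
  filter_upwards [hev, (tendsto_log_pow_mul_div hc).eventually (lt_mem_nhds hs'),
    eventually_gt_atTop 0] with m h1 h2 hm
  have hm' : (0 : ℝ) < m := by exact_mod_cast hm
  set q := (c / (m : ℝ) ^ 2) ^ (4 * m + 7) * Real.exp (-√((m : ℝ) ^ 3)) ^ 2 with hq
  have hq0 : 0 < q := by positivity
  have h3 : (Real.log q : EReal) ≤
      ENNReal.log (μ (scaledCompoundPoisson hN Z (m ^ 3) ⁻¹' counterSet)) := by
    rw [← ENNReal.log_ofReal_of_pos hq0]
    exact ENNReal.log_le_log ((ENNReal.ofReal_le_ofReal h1).trans_eq ofReal_measureReal)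
  have h4 : (((m ^ 3 : ℕ) : ℝ) ^ (1 / 2 : ℝ) : ℝ) = √((m : ℝ) ^ 3) := by
    rw [← Real.sqrt_eq_rpow]
    push_cast
    rfl
  rw [h4]
  calc (s : EReal) ≤ ((Real.log q / √((m : ℝ) ^ 3) : ℝ) : EReal) := by exact_mod_cast h2.le
    _ = (Real.log q : EReal) / (√((m : ℝ) ^ 3) : ℝ) := EReal.coe_div _ _
    _ ≤ _ := EReal.div_le_div_right_of_nonneg (by positivity) h3

end Limit

theorem mainTheorem7 {Ω : Type*} [MeasurableSpace Ω] (μ : Measure Ω) [IsProbabilityMeasure μ]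
    (N : ℝ≥0 → Ω → ℕ) (hN : IsPoissonProcess N 1 μ)
    (Z : ℕ → Ω → ℝ) (hZmeas : ∀ i, Measurable (Z i))
    (hZindep : iIndepFun Z μ) (hZident : ∀ i, IdentDistrib (Z i) (Z 0) μ μ)
    (hNZ : IndepFun (fun ω t => N t ω) (fun ω i => Z i ω) μ)
    (hZtail : Asymptotics.IsEquivalent atTop (fun x : ℝ => μ.real {ω | x ≤ Z 0 ω})
      (fun x : ℝ => Real.exp (-(x ^ (1 / 2 : ℝ)))))
    (hZint : Integrable (Z 0) μ) (hZmean : ∫ ω, Z 0 ω ∂μ = 1) :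
    IsClosed SkorokhodSpace.counterSet ∧
    -2 ≤ limsup (fun n : ℕ =>
      ENNReal.log (μ (scaledCompoundPoisson hN Z n ⁻¹' SkorokhodSpace.counterSet)) /
        (((n : ℝ) ^ (1 / 2 : ℝ) : ℝ) : EReal)) atTop ∧
    3 ≤ ⨅ ξ ∈ SkorokhodSpace.counterSet, SkorokhodSpace.rateFunction (1 / 2) ξ ∧
    ¬ SatisfiesLDP μ (scaledCompoundPoisson hN Z) (fun n : ℕ => (n : ℝ) ^ (1 / 2 : ℝ))
      (SkorokhodSpace.rateFunction (1 / 2)) := by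
  have hlim := neg_two_le_limsup_log_measure_counterSet hN hZmeas hZindep hZident hNZ hZtail hZint
    hZmean
  have hclosed := SkorokhodSpace.isClosed_counterSet
  have hrate := SkorokhodSpace.three_le_iInf_rateFunction
  refine ⟨hclosed, hlim, hrate, fun hLDP => ?_⟩
  have hup := (hLDP _ (MeasurableSpace.measurableSet_generateFrom hclosed.isOpen_compl).of_compl).2
  rw [hclosed.closure_eq] at hup
  have h3 : (3 : EReal) ≤ ((⨅ ξ ∈ SkorokhodSpace.counterSet,
      SkorokhodSpace.rateFunction (1 / 2) ξ : ℝ≥0∞) : EReal) :=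
    EReal.coe_ennreal_le_coe_ennreal_iff.2 hrate
  have h := (hlim.trans hup).trans (EReal.neg_le_neg_iff.2 h3)
  rw [EReal.neg_le_neg_iff] at h
  exact absurd (EReal.coe_le_coe_iff.1 (show ((3 : ℝ) : EReal) ≤ (2 : ℝ) from h)) (by norm_num)
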